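/- **Setting.** Let $\mathcal V$ be a finite set of time series; the series $Z\in\mathcal V$ takes values in a standard Borel space $E_Z$ with a $\sigma$-finite reference measure $\lambda_Z$ (e.g. counting measure for discrete, Lebesgue measure for real variables). Fix a maximal lag $\gamma_{\max}\ge 0$. A *full-time causal graph* (FTCG) is an acyclic directed graph on the variables $Z_s$ ($Z\in\mathcal V$, $s\in\mathbb Z$), invariant under time shifts (consistency throughout time), in which every edge $Z_r\to W_s$ satisfies $0\le s-r\le\gamma_{\max}$. A directed graph $\mathcal G^s$ on $\mathcal V$ (cycles and self-loops allowed) is the *summary causal graph* (SCG) of an FTCG if $Z\to W$ in $\mathcal G^s$ iff $Z_{t-\ell}\to W_t$ in the FTCG for some $0\le\ell\le\gamma_{\max}$; the FTCG is then a *candidate* for $\mathcal G^s$. A *dynamic structural causal model* (DSCM) on an FTCG generates the variables by time-invariant structural equations $Z_s=f_Z(\text{parents of }Z_s,\,U_{Z,s})$ (almost surely), where the noises $U_{Z,s}$ are mutually independent (causal sufficiency), have laws not depending on $s$, and where for each $s$ the noises at times $\ge s$ are jointly independent of all variables before time $s$. It is *positive* if any finitely many variables have a joint law equivalent to (having the same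 null sets as) the product of their reference measures. The intervention $do(X_{t-\gamma}=x_{t-\gamma})$ leaves all variables before time $t-\gamma$ unchanged, replaces the equation of $X_{t-\gamma}$ by the constant $x_{t-\gamma}$, and keeps all other equations and noises; $P(y_t\mid do(x_{t-\gamma}))$ denotes the resulting law of $Y_t$. The total effect $P(y_t\mid do(x_{t-\gamma}))$ is *identifiable* from $\mathcal G^s$ if there is one functional of the observational distribution that equals it, for almost every value $x_{t-\gamma}$, for every positive DSCM on every candidate FTCG of $\mathcal G^s$. A set $\mathcal Z$ of variables is a *valid adjustment set* if for every positive DSCM on every candidate FTCG, for almost every $x_{t-\gamma}$, $$P(y_t\mid do(x_{t-\gamma}))=\int P(y_t\mid x_{t-\gamma},\mathbf z)\,P(d\mathbf z),$$ that is, $\sum_{\mathbf z}P(y_t\mid x_{t-\gamma},\mathbf z)P(\mathbf z)$ for discrete variables. ("Almost every" refers to the law of $X_{t-\gamma}$; for discrete variables with counting reference measure it means every value.) **Graph notions in $\mathcal G^s$.** Every vertex is its own ancestor and descendant. A directed cycle is a sequence of distinct vertices $C^1\to\cdots\to C^k\to C^1$, $k\ge1$ (a self-loop if $k=1$). A path is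 a sequence of distinct vertices in which successive ones are joined by an edge in at least one direction. A path from $X$ to $Y$ is a backdoor path if its first edge is $X\leftarrow$ or $X\leftrightarrows$. It is $\sigma$-active if it contains no $\to Z\leftarrow$ in which neither edge is a double edge $\leftrightarrows$. **Theorem (Identifiability in SCG).** Let $\mathcal G^s$ be a directed graph on $\mathcal V$, $X\neq Y$ two vertices, $\gamma\ge 0$ an integer and $t\in\mathbb Z$. Suppose that $X\notin Anc(Y,\mathcal G^s)$, or that $X\in Anc(Y,\mathcal G^s)$ and none of the following holds: 1. $\gamma\neq 0$ and $\mathcal G^s\setminus\{Y\}$ (the graph with $Y$ and its edges removed) has a directed cycle through $X$ with at least two vertices; 2. there is a $\sigma$-active backdoor path $\langle V^1=X,\dots,V^n=Y\rangle$ from $X$ to $Y$ in $\mathcal G^s$ with $V^2,\dots,V^{n-1}\in Desc(X,\mathcal G^s)$ such that (a) $n>2$, or (b) $n=2$ and $\gamma\neq1$, or (c) $n=2$, $\gamma=1$ and $Y$ lies on a directed cycle of $\mathcal G^s$ (possibly a self-loop) other than $X\leftrightarrows Y$. Then the total effect $P(y_t\mid do(x_{t-\gamma}))$ is identifiable from $\mathcal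 G^s$, and $$\mathcal A_\gamma=\{Z_{t-\gamma-\ell}: 1\le\ell\le\gamma_{\max},\ Z\in Desc(X,\mathcal G^s)\}\cup\{Z_{t-\gamma-\ell}:0\le\ell\le\gamma_{\max},\ Z\in\mathcal V\setminus Desc(X,\mathcal G^s)\}$$ is a valid adjustment set for it. -/

import Mathlib

open MeasureTheory ProbabilityTheory

universe u v w w'

/-! ### Directed graphs (self-loops and cycles allowed) -/

namespace SCG

variable {V : Type u}

/-- `IsAnc G x y`: `x` is an ancestor of `y`, equivalently `y` is a descendant of `x`
(every vertex is its own ancestor and its own descendant). -/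
def IsAnc (G : Digraph V) (x y : V) : Prop := Relation.ReflTransGen G.Adj x y

/-- The set of descendants of `x`. -/
def Desc (G : Digraph V) (x : V) : Set V := {z | IsAnc G x z}

/-- The graph with the vertex `y` and all its edges removed. -/
def removeVertex (G : Digraph V) (y : V) : Digraph V where
  Adj a b := G.Adj a b ∧ a ≠ y ∧ b ≠ y

/-- `c = [x, c₂, …, c_k]` lists the vertices of a directed cycle `x → c₂ → ⋯ → c_k → x`;
`[x]` stands for a self-loop on `x`. -/
def IsCycleThrough (G : Digraph V) (x : V) (c : List V) : Prop :=
  c.Nodup ∧ c.head? = some x ∧ c.IsChain G.Adj ∧ ∃ z, c.getLast? = some z ∧ G.Adj z x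

/-- A path from `x` to `y`: distinct vertices, successive ones being adjacent in some direction. -/
def IsPath (G : Digraph V) (x y : V) (π : List V) : Prop :=
  π.Nodup ∧ π.head? = some x ∧ π.getLast? = some y ∧
    π.IsChain (fun a b => G.Adj a b ∨ G.Adj b a)

/-- A path from `x` to `y` that starts with `x ←` or `x ⇄`. -/
def IsBackdoorPath (G : Digraph V) (x y : V) (π : List V) : Prop :=
  IsPath G x y π ∧ ∃ (a : V) (l : List V), π = x :: a :: l ∧ G.Adj a x

/-- The path contains `→ b ←` where neither of the two edges is bidirected (`⇄`). -/
def SigmaBlocked (G : Digraph V) (π : List V) : Prop :=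
  ∃ a b c : V, [a, b, c] <:+: π ∧
    (G.Adj a b ∧ ¬ G.Adj b a) ∧ (G.Adj c b ∧ ¬ G.Adj b c)

/-- `γ ≠ 0` and some directed cycle through `x` in `G ∖ {y}` has at least two vertices. -/
def CycleCondition (G : Digraph V) (x y : V) (γ : ℕ) : Prop :=
  γ ≠ 0 ∧ ∃ c : List V, IsCycleThrough (removeVertex G y) x c ∧ 2 ≤ c.length

/-- There is a `σ`-active backdoor path from `x` to `y`, with `n` vertices and with interior in
the descendants of `x`, such that `n > 2`, or `n = 2` and `γ ≠ 1`, or `n = 2`, `γ = 1` and `y`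
lies on a directed cycle other than `x ⇄ y`. -/
def BackdoorCondition (G : Digraph V) (x y : V) (γ : ℕ) : Prop :=
  ∃ π : List V, IsBackdoorPath G x y π ∧ ¬ SigmaBlocked G π ∧
    (∀ z ∈ π.tail.dropLast, z ∈ Desc G x) ∧
    (2 < π.length ∨
      (π.length = 2 ∧ γ ≠ 1) ∨
      (π.length = 2 ∧ γ = 1 ∧ ∃ c : List V, IsCycleThrough G y c ∧ c ≠ [y, x]))

/-- The set `A_γ` of the variables `Z_{t-γ-ℓ}` with `1 ≤ ℓ ≤ γmax` for `Z` a descendant of `x`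
and with `0 ≤ ℓ ≤ γmax` for the other `Z`. -/
def adjustmentSet (G : Digraph V) (γmax : ℕ) (x : V) (γ : ℕ) (t : ℤ) : Set (V × ℤ) :=
  {p | ∃ ℓ : ℕ, p.2 = t - γ - ℓ ∧ 1 ≤ ℓ ∧ ℓ ≤ γmax ∧ p.1 ∈ Desc G x} ∪
    {p | ∃ ℓ : ℕ, p.2 = t - γ - ℓ ∧ ℓ ≤ γmax ∧ p.1 ∉ Desc G x}

end SCG

/-! ### Full-time causal graphs -/

/-- A full-time causal graph on the variables `(Z, s)` (the series `Z` at time `s`), with maximal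
lag at most `γmax`, acyclic, and invariant under time shifts (consistency throughout time). -/
structure FTCG (V : Type u) (γmax : ℕ) where
  Edge : V × ℤ → V × ℤ → Prop
  time_le : ∀ p q, Edge p q → p.2 ≤ q.2
  lag_le : ∀ p q, Edge p q → q.2 - p.2 ≤ γmax
  acyclic : ∀ p, ¬ Relation.TransGen Edge p p
  shift : ∀ (a b : V) (r s k : ℤ), Edge (a, r) (b, s) ↔ Edge (a, r + k) (b, s + k)

namespace FTCG

variable {V : Type u} {γmax : ℕ}

/-- The full-time causal graph `G` is a candidate for the summary causal graph `Gs`, that is,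
`Gs` is derived from `G`. -/
def IsCandidate (G : FTCG V γmax) (Gs : Digraph V) : Prop :=
  ∀ (a b : V) (t : ℤ), Gs.Adj a b ↔ ∃ ℓ : ℕ, ℓ ≤ γmax ∧ G.Edge (a, t - ℓ) (b, t)

/-- Parents of the variables of the series `b`, as (series, relative time ≤ 0). -/
abbrev Par (G : FTCG V γmax) (b : V) : Type u := {q : V × ℤ // G.Edge q (b, 0)}

theorem Par.edge {G : FTCG V γmax} {b : V} (q : G.Par b) (s : ℤ) :
    G.Edge (q.1.1, q.1.2 + s) (b, s) := by
  have h := (G.shift q.1.1 b q.1.2 0 s).1 q.2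
  rwa [zero_add] at h

/-- From time `t₀` on, the graph can be computed recursively. -/
theorem wellFounded_from [Finite V] (G : FTCG V γmax) (t₀ : ℤ) :
    WellFounded (fun p q : V × ℤ => G.Edge p q ∧ t₀ ≤ q.2) := by
  have key : ∀ n : ℕ, ∀ p : V × ℤ, p.2 < t₀ + n →
      Acc (fun p q : V × ℤ => G.Edge p q ∧ t₀ ≤ q.2) p := by
    intro n
    induction n with
    | zero =>
      intro p hp
      refine Acc.intro _ fun q hq => ?_
      have := hq.2
      push_cast at hp
      omega
    | succ n ih =>
      rintro ⟨b, s⟩ hp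
      by_cases hs : s < t₀ + n
      · exact ih (b, s) hs
      let r : V → V → Prop := fun a b => Relation.TransGen G.Edge (a, s) (b, s)
      have : IsTrans V r := ⟨fun _ _ _ h₁ h₂ => Relation.TransGen.trans h₁ h₂⟩
      have : Std.Irrefl r := ⟨fun a => G.acyclic (a, s)⟩
      induction b using (Finite.wellFounded_of_trans_of_irrefl r).induction with
      | _ b ihb =>
        refine Acc.intro _ ?_
        rintro ⟨a, s'⟩ hq
        have hle : s' ≤ s := G.time_le _ _ hq.1
        by_cases h : s' < t₀ + n
        · exact ih (a, s') h
        have hss : s' = s := by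
          simp only at hp
          push_cast at hp
          omega
        subst hss
        exact ihb a (Relation.TransGen.single hq.1) hp
  refine ⟨fun p => key (p.2 - t₀ + 1).toNat p ?_⟩
  have := Int.self_le_toNat (p.2 - t₀ + 1)
  omega

end FTCG

/-! ### Dynamic structural causal models -/

/-- A dynamic structural causal model whose full-time causal graph is `G`, together with the
process that it generates. The variable `b` at time `s` is
`X (b, s) = f b (values of the parents of (b, s)) (U (b, s))`.
The mechanisms `f` and the laws of the noises do not depend on time, and the noises are mutually
independent (no hidden common cause). As time has no origin, the structural equations alone do not
say that the process runs forward in time: `noise_indep_past` does. -/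
structure DSCM {V : Type u} {γmax : ℕ} (G : FTCG V γmax) (E : V → Type v)
    [∀ b, MeasurableSpace (E b)] where
  Noise : V → Type w
  [measurableSpaceNoise : ∀ b, MeasurableSpace (Noise b)]
  Ω : Type w'
  [measurableSpaceΩ : MeasurableSpace Ω]
  P : Measure Ω
  [isProbabilityMeasure : IsProbabilityMeasure P]
  f : ∀ b : V, (∀ q : G.Par b, E q.1.1) → Noise b → E b
  measurable_f : ∀ b : V,
    Measurable (fun z : (∀ q : G.Par b, E q.1.1) × Noise b => f b z.1 z.2)
  U : ∀ p : V × ℤ, Ω → Noise p.1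
  measurable_U : ∀ p, Measurable (U p)
  noise_law : ∀ (b : V) (s s' : ℤ), P.map (U (b, s)) = P.map (U (b, s'))
  noise_indep : iIndepFun U P
  X : ∀ p : V × ℤ, Ω → E p.1
  measurable_X : ∀ p, Measurable (X p)
  structural : ∀ (b : V) (s : ℤ), ∀ᵐ ω ∂P,
    X (b, s) ω = f b (fun q => X (q.1.1, q.1.2 + s) ω) (U (b, s) ω)
  noise_indep_past : ∀ s : ℤ, IndepFun
    (fun ω (p : {p : V × ℤ // s ≤ p.2}) => U p.1 ω)
    (fun ω (p : {p : V × ℤ // p.2 < s}) => X p.1 ω) P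

attribute [instance] DSCM.measurableSpaceNoise DSCM.measurableSpaceΩ DSCM.isProbabilityMeasure

namespace DSCM

variable {V : Type u} {γmax : ℕ} {G : FTCG V γmax} {E : V → Type v} [∀ b, MeasurableSpace (E b)]

/-- The observational distribution, a law on trajectories. -/
noncomputable def obsLaw (M : DSCM.{u, v, w, w'} G E) : Measure (∀ p : V × ℤ, E p.1) :=
  M.P.map (fun ω p => M.X p ω)

/-- Positivity: with respect to the reference measures `lam` (counting measure for discrete
variables, Lebesgue measure for real ones), finitely many variables have a joint density that is
positive almost everywhere. -/
def IsPositive (M : DSCM.{u, v, w, w'} G E) (lam : ∀ b, Measure (E b)) : Prop :=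
  ∀ S : Finset (V × ℤ),
    (M.P.map (fun ω (p : S) => M.X p.1 ω)) ≪ Measure.pi (fun p : S => lam p.1.1) ∧
    Measure.pi (fun p : S => lam p.1.1) ≪ (M.P.map (fun ω (p : S) => M.X p.1 ω))

open Classical in
/-- The process under the intervention `do(X i = a)`: nothing changes before the time of `i`, the
variable `i` is set to `a`, and every other variable from then on is computed by its own mechanism
with its own noise. -/
noncomputable def doX [Finite V] (M : DSCM.{u, v, w, w'} G E) (i : V × ℤ) (a : E i.1) (ω : M.Ω) :
    ∀ p : V × ℤ, E p.1 :=
  (G.wellFounded_from i.2).fix (C := fun p => E p.1) fun p rec =>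
    if hp : p.2 < i.2 then M.X p ω
    else if h : p = i then h ▸ a
    else M.f p.1 (fun q => rec (q.1.1, q.1.2 + p.2) ⟨q.edge p.2, not_lt.1 hp⟩) (M.U p ω)

section Unfold

variable [Finite V] (M : DSCM.{u, v, w, w'} G E) (i : V × ℤ) (a : E i.1) (ω : M.Ω)

theorem doX_of_lt (p : V × ℤ) (hp : p.2 < i.2) : M.doX i a ω p = M.X p ω := by
  rw [doX, WellFounded.fix_eq, dif_pos hp]

theorem doX_self : M.doX i a ω i = a := by
  rw [doX, WellFounded.fix_eq, dif_neg (lt_irrefl _), dif_pos rfl]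

theorem doX_of_ne (p : V × ℤ) (hp : i.2 ≤ p.2) (h : p ≠ i) :
    M.doX i a ω p = M.f p.1 (fun q => M.doX i a ω (q.1.1, q.1.2 + p.2)) (M.U p ω) := by
  rw [doX, WellFounded.fix_eq, dif_neg (not_lt.2 hp), dif_neg h]

end Unfold

/-- The total effect `P(X j ∈ · | do(X i = a))`. -/
noncomputable def effect [Finite V] (M : DSCM.{u, v, w, w'} G E) (i j : V × ℤ) (a : E i.1) :
    Measure (E j.1) :=
  M.P.map (fun ω => M.doX i a ω j)

/-- The adjustment formula
`P(X j ∈ · | do(X i = a)) = ∫ P(X j ∈ · | X i = a, X Z = z) P(X Z ∈ dz)`, for almost every `a`. -/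
def AdjustmentFormula [Finite V] [∀ b, StandardBorelSpace (E b)] [∀ b, Nonempty (E b)]
    (M : DSCM.{u, v, w, w'} G E) (i j : V × ℤ) (Z : Set (V × ℤ)) : Prop :=
  ∀ᵐ a ∂(M.P.map (M.X i)), ∀ B : Set (E j.1), MeasurableSet B →
    M.effect i j a B =
      ∫⁻ z, condDistrib (M.X j) (fun ω => (M.X i ω, fun p : Z => M.X p.1 ω)) M.P (a, z) B
        ∂(M.P.map (fun ω (p : Z) => M.X p.1 ω))

end DSCM

/-! ### Identification from a summary causal graph -/

namespace SCG

variable {V : Type u} [Finite V] (E : V → Type v) [∀ b, MeasurableSpace (E b)]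

/-- The effect of `i` on `j` is one and the same functional `Φ` of the observational distribution
for all positive models on all candidate full-time causal graphs of `Gs`. -/
def IsIdentifiable (lam : ∀ b, Measure (E b)) (Gs : Digraph V) (γmax : ℕ) (i j : V × ℤ) : Prop :=
  ∃ Φ : Measure (∀ p : V × ℤ, E p.1) → E i.1 → Measure (E j.1),
    ∀ G : FTCG V γmax, G.IsCandidate Gs → ∀ M : DSCM.{u, v, w, w'} G E, M.IsPositive lam →
      ∀ᵐ a ∂(M.P.map (M.X i)), M.effect i j a = Φ M.obsLaw a

/-- The adjustment formula with the set `Z` holds for all positive models on all candidate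
full-time causal graphs of `Gs`. -/
def IsValidAdjustmentSet [∀ b, StandardBorelSpace (E b)] [∀ b, Nonempty (E b)]
    (lam : ∀ b, Measure (E b)) (Gs : Digraph V) (γmax : ℕ) (i j : V × ℤ) (Z : Set (V × ℤ)) : Prop :=
  ∀ G : FTCG V γmax, G.IsCandidate Gs → ∀ M : DSCM.{u, v, w, w'} G E, M.IsPositive lam →
    M.AdjustmentFormula i j Z

end SCG

/-! Write i = X_{t-γ}, j = Y_t, A = A_γ. The proof is a backdoor adjustment in which separation is
replaced by an explicit functional representation of Y_t. Let S (`forwardSet`) be the variables from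
time t-γ on, outside A ∪ {i}, with a directed path to j that avoids i. By the lag bound, parents of
S lie in S ∪ A ∪ {i}, so solving the structural equations on S gives Y_t = H(X_i, X_A, U_S). If S
contains no ancestor of A ∪ {i}, then U_S is independent of (X_i, X_A) (`indepFun_noise`), and the
conditional law of Y_t given (a, z) is the law of H(a, z, U_S). As A contains no descendant of i,
under do(a) the outcome is H(a, X_A, U_S) with the same X_A, and integrating over z gives the
formula (`adjustmentFormula_of_separated`). Positivity makes the almost-sure conditional law usable
under the product of the marginals. The formula involves only the observational law, hence
identifiability.

The two graph conditions serve only to show that no p in S is an ancestor of i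
(`forwardSet_not_reflTransGen_treatment`). Such a p has time t-γ, and its series is another vertex
of the strong component of X. For γ = 0 its path to Y_t stays in one time slice, and
`exists_backdoorPath` yields a forbidden backdoor path. For γ ≠ 0, `eq_of_mem_strongComponent`
leaves only p = Y_{t-1} with γ = 1 and no self-loop on Y, and time invariance then produces a cycle
in the full-time graph. -/

namespace SCG

/-! ### Cycles, backdoor paths and the strong component of X in the summary graph. -/

variable {V : Type u}

theorem exists_nodup_isChain {r : V → V → Prop} {a b : V} (h : Relation.ReflTransGen r a b) :
    ∃ l : List V, (a :: l).Nodup ∧ (a :: l).IsChain r ∧ (a :: l).getLast? = some b := by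
  induction h using Relation.ReflTransGen.head_induction_on with
  | refl => exact ⟨[], by simp, by simp, by simp⟩
  | @head a c hac _ ih =>
    obtain ⟨l, hn, hc, hl⟩ := ih
    -- If `a` already occurs on the path, the part from that occurrence on is the required path.
    by_cases ha : a ∈ c :: l
    · obtain ⟨s, t, hst⟩ := List.append_of_mem ha
      rw [hst] at hn hc hl
      exact ⟨t, hn.of_append_right, hc.right_of_append, by simpa using hl⟩
    · refine ⟨c :: l, List.nodup_cons.2 ⟨ha, hn⟩, List.isChain_cons_cons.2 ⟨hac, hc⟩, ?_⟩
      simpa using hl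

theorem reflTransGen_of_mem_isChain {r : V → V → Prop} {a z : V} {l : List V}
    (h : (a :: l).IsChain r) (hz : z ∈ a :: l) : Relation.ReflTransGen r a z := by
  induction l generalizing a with
  | nil => simp at hz; subst hz; exact .refl
  | cons b l ih =>
    rw [List.isChain_cons_cons] at h
    rcases List.mem_cons.1 hz with rfl | hz
    · exact .refl
    · exact .head h.1 (ih h.2 hz)

theorem reflTransGen_to_getLast {r : V → V → Prop} {b z : V} {l : List V}
    (h : l.IsChain r) (hz : z ∈ l) (hb : l.getLast? = some b) : Relation.ReflTransGen r z b := by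
  obtain ⟨s, t, rfl⟩ := List.append_of_mem hz
  refine reflTransGen_of_mem_isChain (l := t) h.right_of_append ?_
  exact List.mem_of_getLast? (by simpa using hb)

/-- A directed edge `x → v` and a way back close up to a directed cycle with second vertex `v`. -/
theorem exists_cycle_of_adj {G : Digraph V} {x v : V} (hv : v ≠ x) (hxv : G.Adj x v)
    (h : IsAnc G v x) : ∃ l : List V, IsCycleThrough G x (x :: v :: l) := by
  obtain ⟨l, hn, hc, hl⟩ := exists_nodup_isChain h
  obtain ⟨m, hm⟩ : ∃ m, v :: l = m ++ [x] := by
    rw [List.getLast?_eq_some_iff] at hl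
    exact hl
  cases m with
  | nil => simp at hm; exact absurd hm.1 hv
  | cons v' m =>
    obtain ⟨rfl, rfl⟩ : v = v' ∧ l = m ++ [x] := by simpa using hm
    rw [hm] at hn hc
    rw [List.isChain_append] at hc
    refine ⟨m, ?_, by simp, ?_, ?_⟩
    · rw [List.nodup_append_comm] at hn
      simpa using hn
    · exact List.isChain_cons_cons.2 ⟨hxv, hc.1⟩
    · obtain ⟨z, hz⟩ : ∃ z, (v :: m).getLast? = some z :=
        ⟨_, List.getLast?_eq_some_getLast (by simp)⟩
      refine ⟨z, by simpa using hz, ?_⟩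
      exact hc.2.2 z hz x (by simp)

/-- A directed path from `x` to `v` and an edge `v → x` close up to a cycle with last vertex `v`. -/
theorem exists_cycle_of_adj_last {G : Digraph V} {x v : V} (hvx : G.Adj v x)
    (h : IsAnc G x v) : ∃ c : List V, IsCycleThrough G x c ∧ c.getLast? = some v := by
  obtain ⟨l, hn, hc, hl⟩ := exists_nodup_isChain h
  exact ⟨x :: l, ⟨hn, by simp, hc, v, hl, hvx⟩, hl⟩

theorem IsAnc.exists_adj_ne {G : Digraph V} {x z : V} (h : IsAnc G x z) (hz : z ≠ x) :
    ∃ v, v ≠ x ∧ G.Adj x v ∧ IsAnc G v z := by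
  induction h with
  | refl => exact absurd rfl hz
  | @tail b c hb hbc ih =>
    by_cases hbx : b = x
    · subst hbx; exact ⟨c, hz, hbc, .refl⟩
    · obtain ⟨v, hv, hxv, h⟩ := ih hbx
      exact ⟨v, hv, hxv, h.tail hbc⟩

theorem exists_cycle_of_isAnc {G : Digraph V} {x z : V} (h : IsAnc G x z) (hz : z ≠ x)
    (h' : IsAnc G z x) : ∃ c : List V, IsCycleThrough G x c ∧ 2 ≤ c.length := by
  obtain ⟨v, hv, hxv, hvz⟩ := h.exists_adj_ne hz
  obtain ⟨l, hl⟩ := exists_cycle_of_adj hv hxv (hvz.trans h')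
  exact ⟨_, hl, by simp⟩

/-- Up to the top `w` of the fork every vertex points to its predecessor, and from `w` on to its
successor, so no interior vertex is a one-way collider. -/
theorem adj_or_adj_of_infix_fork {G : Digraph V} {w a b c : V} {k m : List V}
    (h₁ : (k ++ [w]).IsChain (flip G.Adj)) (h₂ : (w :: m).IsChain G.Adj)
    (h : [a, b, c] <:+: k ++ w :: m) : G.Adj b a ∨ G.Adj b c := by
  induction k with
  | nil =>
    have := h₂.infix h
    simp at this
    exact .inr this.2
  | cons d k ih =>
    rw [List.cons_append, List.infix_cons_iff] at h
    rcases h with h | h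
    · left
      rw [List.cons_prefix_cons] at h
      obtain ⟨rfl, h⟩ := h
      cases k with
      | nil =>
        simp at h₁ h
        obtain ⟨rfl, -⟩ := h
        exact h₁
      | cons e k =>
        simp only [List.cons_append, List.isChain_cons_cons] at h₁
        rw [List.cons_append, List.cons_prefix_cons] at h
        obtain ⟨rfl, -⟩ := h
        exact h₁.1
    · exact ih (by simpa using h₁.tail) h

/-- A fork `x ← ⋯ ← w → ⋯ → y` is a `σ`-active backdoor path. -/
theorem isBackdoorPath_of_fork {G : Digraph V} {x y w : V} {k m : List V}
    (hn : (x :: k ++ w :: m).Nodup) (h₁ : (x :: k ++ [w]).IsChain (flip G.Adj))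
    (h₂ : (w :: m).IsChain G.Adj) (hl : (w :: m).getLast? = some y) :
    IsBackdoorPath G x y (x :: k ++ w :: m) ∧ ¬ SigmaBlocked G (x :: k ++ w :: m) := by
  refine ⟨⟨⟨hn, by simp, by rw [List.getLast?_append_of_ne_nil _ (by simp), hl], ?_⟩, ?_⟩, ?_⟩
  · rw [List.isChain_split]
    exact ⟨h₁.imp fun _ _ h => .inr h, h₂.imp fun _ _ h => .inl h⟩
  · cases k with
    | nil => exact ⟨w, m, by simp, by simpa [flip] using h₁⟩
    | cons a k =>
      refine ⟨a, k ++ w :: m, by simp, ?_⟩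
      simp only [List.cons_append, List.isChain_cons_cons] at h₁
      exact h₁.1
  · rintro ⟨a, b, c, h, ⟨-, hba⟩, -, hbc⟩
    exact (adj_or_adj_of_infix_fork h₁ h₂ h).elim hba hbc

theorem removeVertex_le {G : Digraph V} {x a b : V} (h : IsAnc (removeVertex G x) a b) :
    IsAnc G a b :=
  Relation.ReflTransGen.mono (fun _ _ h => h.1) _ _ h

/-- If a descendant `w` of `x` is an ancestor of `x`, and an ancestor of `y` avoiding `x`, there is
a `σ`-active backdoor path from `x` to `y` among the descendants of `x`. -/
theorem exists_backdoorPath {G : Digraph V} {x y w : V} (hxy : x ≠ y) (hxw : IsAnc G x w)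
    (hwx : IsAnc G w x) (hwy : IsAnc (removeVertex G x) w y) :
    ∃ π : List V, IsBackdoorPath G x y π ∧ ¬ SigmaBlocked G π ∧ (∀ z ∈ π, z ∈ Desc G x) ∧
      2 ≤ π.length := by
  -- On a walk from `w` (good) to `x` (not good), take the last edge `a → b` leaving the good
  -- vertices. The fork at `a` consists of a good branch to `y` and a branch to `x` without good
  -- vertices, so the branches are disjoint.
  let good : V → Prop := fun v => IsAnc (removeVertex G x) v y
  let r : V → V → Prop := fun a b => G.Adj a b ∧ ¬ good a ∧ ¬ good b
  have hxg : ¬ good x := by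
    intro h
    rcases Relation.ReflTransGen.cases_head h with h | ⟨c, h, -⟩
    · exact hxy h
    · exact h.2.1 rfl
  have key : ∀ v, IsAnc G v x → IsAnc G x v → (Relation.ReflTransGen r v x ∧ ¬ good v) ∨
      ∃ a b, G.Adj a b ∧ good a ∧ ¬ good b ∧ Relation.ReflTransGen r b x ∧ IsAnc G x a := by
    intro v hv
    induction hv using Relation.ReflTransGen.head_induction_on with
    | refl => exact fun _ => .inl ⟨.refl, hxg⟩
    | @head v c hvc _ ih =>
      intro hxv
      rcases ih (hxv.tail hvc) with ⟨h, hc⟩ | h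
      · by_cases hg : good v
        · exact .inr ⟨v, c, hvc, hg, hc, h, hxv⟩
        · exact .inl ⟨.head ⟨hvc, hg, hc⟩ h, hg⟩
      · exact .inr h
  rcases key w hwx hxw with h | ⟨a, b, hab, ha, hb, hbx, hxa⟩
  · exact absurd hwy h.2
  obtain ⟨l, ln, lc, ll⟩ := exists_nodup_isChain hbx
  obtain ⟨m, mn, mc, ml⟩ := exists_nodup_isChain (show Relation.ReflTransGen _ a y from ha)
  have hm : ∀ z ∈ a :: m, good z := fun z hz => reflTransGen_to_getLast mc hz ml
  have hlr : ∀ z ∈ b :: l, ¬ good z := by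
    intro z hz
    rcases Relation.ReflTransGen.cases_tail (reflTransGen_of_mem_isChain lc hz) with h | ⟨c, -, h⟩
    · rwa [h]
    · exact h.2.2
  obtain ⟨k, hk⟩ : ∃ k, (b :: l).reverse = x :: k := by
    obtain ⟨k, hk⟩ := List.getLast?_eq_some_iff.1 ll
    exact ⟨k.reverse, by rw [hk]; simp⟩
  have hmem : ∀ z, z ∈ x :: k ↔ z ∈ b :: l := fun z => by rw [← hk, List.mem_reverse]
  obtain ⟨h1, h2⟩ := isBackdoorPath_of_fork (G := G) (x := x) (y := y) (w := a) (k := k) (m := m)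
    (by
      rw [List.nodup_append]
      refine ⟨by rw [← hk]; exact List.nodup_reverse.2 ln, mn, ?_⟩
      rintro z hz _ hz' rfl
      exact hlr z ((hmem z).1 hz) (hm z hz'))
    (by
      rw [← hk, ← List.reverse_cons, List.isChain_reverse]
      exact List.isChain_cons_cons.2 ⟨hab, lc.imp fun _ _ h => h.1⟩)
    (mc.imp fun _ _ h => h.1) ml
  refine ⟨_, h1, h2, ?_, by simp; omega⟩
  intro z hz
  rcases List.mem_append.1 hz with hz | hz
  · have h3 : IsAnc G b z :=
      Relation.ReflTransGen.mono (fun _ _ h => h.1) _ _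
        (reflTransGen_of_mem_isChain lc ((hmem z).1 hz))
    exact (hxa.tail hab).trans h3
  · exact hxa.trans (removeVertex_le (reflTransGen_of_mem_isChain mc hz))

/-- If `y` is not an ancestor of `b`, directed paths to `b` avoid `y`. -/
theorem IsAnc.removeVertex {G : Digraph V} {a b y : V} (h : IsAnc G a b) (hy : ¬ IsAnc G y b) :
    IsAnc (removeVertex G y) a b := by
  induction h using Relation.ReflTransGen.head_induction_on with
  | refl => exact .refl
  | @head a c hac hcb ih =>
    refine .head ⟨hac, ?_, ?_⟩ ih
    · rintro rfl; exact hy (.head hac hcb)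
    · rintro rfl; exact hy hcb

/-- If neither condition holds and `γ ≠ 0`, the strong component of `x` is `{x}`, or it is
`{x, y}`, `γ = 1` and `y` has no self-loop. -/
theorem eq_of_mem_strongComponent {G : Digraph V} {x y : V} {γ : ℕ} (hxy : x ≠ y) (hγ : γ ≠ 0)
    (hanc : IsAnc G x y) (h₁ : ¬ CycleCondition G x y γ) (h₂ : ¬ BackdoorCondition G x y γ)
    {w : V} (hw : w ≠ x) (hxw : IsAnc G x w) (hwx : IsAnc G w x) :
    w = y ∧ γ = 1 ∧ ¬ G.Adj y y := by
  have hcyc : ∀ w, w ≠ x → IsAnc (removeVertex G y) x w → ¬ IsAnc (removeVertex G y) w x :=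
    fun w hw h h' => h₁ ⟨hγ, exists_cycle_of_isAnc h hw h'⟩
  -- Otherwise no path ending in `x` meets `y`, and the cycle through `x` and `w` survives in `G ∖
  -- {y}`.
  have hyx : IsAnc G y x := by
    by_contra hyx
    refine hcyc w hw (hxw.removeVertex fun h => hyx (h.trans hwx)) (hwx.removeVertex hyx)
  -- The fork is taken with `w = y`; the failure of (a), (b) and (c) for this path then forces
  -- length 2, `γ = 1`, and `[y, x]` as the only cycle through `y`.
  obtain ⟨π, hπ, hb, hd, h2⟩ := exists_backdoorPath hxy hanc hyx .refl
  have hcond : ¬ (2 < π.length ∨ (π.length = 2 ∧ γ ≠ 1) ∨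
      (π.length = 2 ∧ γ = 1 ∧ ∃ c : List V, IsCycleThrough G y c ∧ c ≠ [y, x])) := fun h =>
    h₂ ⟨π, hπ, hb, fun z hz => hd z (List.mem_of_mem_tail (List.mem_of_mem_dropLast hz)), h⟩
  have hlen : π.length = 2 := by
    by_contra h; exact hcond (.inl (by omega))
  have hγ1 : γ = 1 := by
    by_contra h; exact hcond (.inr (.inl ⟨hlen, h⟩))
  have hc : ∀ c, IsCycleThrough G y c → c = [y, x] := by
    intro c hc
    by_contra h
    exact hcond (.inr (.inr ⟨hlen, hγ1, c, hc, h⟩))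
  have hloop : ¬ G.Adj y y := fun h => by
    simpa using hc [y] ⟨by simp, by simp, by simp, y, by simp, h⟩
  have hout : ∀ v, G.Adj y v → v ≠ y → IsAnc G v y → v = x := by
    intro v hv hne h
    obtain ⟨l, hl⟩ := exists_cycle_of_adj hne hv h
    have := hc _ hl
    simp at this
    exact this.1
  have hin : ∀ v, G.Adj v y → IsAnc G y v → v = x := by
    intro v hv h
    obtain ⟨c, h, h'⟩ := exists_cycle_of_adj_last hv h
    rw [hc _ h] at h'
    simpa using h'.symm
  refine ⟨?_, hγ1, hloop⟩
  by_contra hwy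
  -- Inside the strong component `y` can be entered and left only through `x`. Cutting paths there
  -- shows that any third vertex lies on a closed walk through `x` avoiding `y`.
  have to_x : ∀ v, IsAnc G v y → IsAnc G y v → v ≠ y → IsAnc (removeVertex G y) v x := by
    intro v hv
    induction hv using Relation.ReflTransGen.head_induction_on with
    | refl => exact fun _ h => absurd rfl h
    | @head v c hvc hcy ih =>
      intro hyv hv
      by_cases hcy' : c = y
      · subst hcy'; rw [hin v hvc hyv]; exact .refl
      · exact .head ⟨hvc, hv, hcy'⟩ (ih (hyv.tail hvc) hcy')
  have from_x : ∀ v, IsAnc G y v → IsAnc G v y → v ≠ y → IsAnc (removeVertex G y) x v := by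
    intro v hv
    induction hv with
    | refl => exact fun _ h => absurd rfl h
    | @tail c v hyc hcv ih =>
      intro hvy hv
      by_cases hcy : c = y
      · subst hcy; rw [hout v hcv hv hvy]; exact .refl
      · exact .tail (ih (.head hcv hvy) hcy) ⟨hcv, hcy, hv⟩
  have hyw : IsAnc G y w := hyx.trans hxw
  have hwy' : IsAnc G w y := hwx.trans hanc
  exact hcyc w hw (from_x w hyw hwy' hwy) (to_x w hwy' hyw hwy)

end SCG

/-! ### Separation in the full-time graph. -/

namespace FTCG

variable {V : Type u} {γmax : ℕ} {G : FTCG V γmax} {Gs : Digraph V}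

theorem IsCandidate.adj (hG : G.IsCandidate Gs) {p q : V × ℤ} (h : G.Edge p q) :
    Gs.Adj p.1 q.1 := by
  have h₁ := G.time_le _ _ h
  have h₂ := G.lag_le _ _ h
  refine (hG p.1 q.1 q.2).2 ⟨(q.2 - p.2).toNat, by omega, ?_⟩
  rwa [Int.toNat_of_nonneg (by omega), sub_sub_cancel]

theorem IsCandidate.isAnc (hG : G.IsCandidate Gs) {p q : V × ℤ}
    (h : Relation.ReflTransGen G.Edge p q) : SCG.IsAnc Gs p.1 q.1 :=
  Relation.ReflTransGen.lift Prod.fst (fun _ _ h => hG.adj h) _ _ h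

theorem snd_le_of_reflTransGen {p q : V × ℤ} (h : Relation.ReflTransGen G.Edge p q) :
    p.2 ≤ q.2 := by
  induction h with
  | refl => exact le_rfl
  | tail _ h ih => exact ih.trans (G.time_le _ _ h)

theorem reflTransGen_shift {p q : V × ℤ} (k : ℤ) (h : Relation.ReflTransGen G.Edge p q) :
    Relation.ReflTransGen G.Edge (p.1, p.2 + k) (q.1, q.2 + k) :=
  Relation.ReflTransGen.lift (fun p : V × ℤ => (p.1, p.2 + k))
    (fun a b h => (G.shift a.1 b.1 a.2 b.2 k).1 h) _ _ h

theorem eq_of_reflTransGen_of_reflTransGen {p q : V × ℤ} (h : Relation.ReflTransGen G.Edge p q)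
    (h' : Relation.ReflTransGen G.Edge q p) : p = q := by
  rcases Relation.reflTransGen_iff_eq_or_transGen.1 h with h | h
  · exact h.symm
  · exact absurd (h.trans_left h') (G.acyclic p)

variable (G) in
/-- The edges of `G` that avoid the variable `i`. -/
def EdgeAvoiding (i p q : V × ℤ) : Prop := G.Edge p q ∧ p ≠ i ∧ q ≠ i

variable (G) in
/-- The variables from the time of `i` on, outside `A ∪ {i}`, with a directed path to `j` that
avoids `i`. -/
def forwardSet (A : Set (V × ℤ)) (i j : V × ℤ) : Set (V × ℤ) :=
  {p | i.2 ≤ p.2 ∧ p ∉ A ∧ p ≠ i ∧ Relation.ReflTransGen (G.EdgeAvoiding i) p j}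

theorem reflTransGen_of_avoiding {i p q : V × ℤ}
    (h : Relation.ReflTransGen (G.EdgeAvoiding i) p q) : Relation.ReflTransGen G.Edge p q :=
  Relation.ReflTransGen.mono (fun _ _ h => h.1) _ _ h

/-- Time cannot decrease along the path, so it stays in the slice of `i`, where the only variable of
the series `i.1` is `i` itself. -/
theorem isAnc_removeVertex_of_avoiding (hG : G.IsCandidate Gs) {i p q : V × ℤ}
    (h : Relation.ReflTransGen (G.EdgeAvoiding i) p q) (hp : i.2 ≤ p.2) (hq : q.2 = i.2) :
    SCG.IsAnc (SCG.removeVertex Gs i.1) p.1 q.1 := by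
  induction h using Relation.ReflTransGen.head_induction_on with
  | refl => exact .refl
  | @head p c hpc hcq ih =>
    have h₁ := G.time_le _ _ hpc.1
    have h₂ := snd_le_of_reflTransGen (reflTransGen_of_avoiding hcq)
    refine .head ⟨hG.adj hpc.1, fun h => hpc.2.1 (Prod.ext h ?_),
      fun h => hpc.2.2 (Prod.ext h ?_)⟩ (ih ?_) <;> omega

variable {γ : ℕ} {t : ℤ} {x y : V}

theorem mem_adjustmentSet_of_lt {p : V × ℤ} (h₁ : p.2 < t - γ) (h₂ : t - γ - γmax ≤ p.2) :
    p ∈ SCG.adjustmentSet Gs γmax x γ t := by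
  by_cases hp : p.1 ∈ SCG.Desc Gs x
  · exact .inl ⟨(t - γ - p.2).toNat, by omega, by omega, by omega, hp⟩
  · exact .inr ⟨(t - γ - p.2).toNat, by omega, by omega, hp⟩

theorem mem_adjustmentSet_of_notMem_desc {p : V × ℤ} (h₁ : p.2 = t - γ)
    (hp : p.1 ∉ SCG.Desc Gs x) : p ∈ SCG.adjustmentSet Gs γmax x γ t :=
  .inr ⟨0, by simpa using h₁, by omega, hp⟩

theorem snd_lt_or_notMem_desc {p : V × ℤ} (h : p ∈ SCG.adjustmentSet Gs γmax x γ t) :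
    p.2 < t - γ ∨ (p.2 = t - γ ∧ p.1 ∉ SCG.Desc Gs x) := by
  rcases h with ⟨ℓ, h, h1, -, -⟩ | ⟨ℓ, h, -, hp⟩
  · left; omega
  · by_cases h0 : ℓ = 0
    · right; exact ⟨by omega, hp⟩
    · left; omega

theorem finite_adjustmentSet [Finite V] : (SCG.adjustmentSet Gs γmax x γ t).Finite := by
  refine (Set.finite_univ.prod (Set.finite_Icc (t - γ - γmax) (t - γ))).subset ?_
  rintro p (⟨ℓ, h, -, h', -⟩ | ⟨ℓ, h, h', -⟩) <;>
    exact ⟨trivial, Set.mem_Icc.2 ⟨by omega, by omega⟩⟩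

/-- The adjustment set contains no descendant of the treatment. -/
theorem not_reflTransGen_adjustmentSet (hG : G.IsCandidate Gs) {q : V × ℤ}
    (hq : q ∈ SCG.adjustmentSet Gs γmax x γ t) :
    ¬ Relation.ReflTransGen G.Edge (x, t - (γ : ℤ)) q := by
  intro h
  have h₁ := snd_le_of_reflTransGen h
  rcases snd_lt_or_notMem_desc hq with h₂ | h₂
  · exact absurd h₁ (not_le.2 h₂)
  · exact h₂.2 (hG.isAnc h)

/-- A parent before time t-γ is within `γmax` of that time, hence in the window covered by the
adjustment set; a later one inherits the path to Y_t. -/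
theorem forwardSet_parent {p q : V × ℤ}
    (hp : p ∈ G.forwardSet (SCG.adjustmentSet Gs γmax x γ t) (x, t - (γ : ℤ)) (y, t))
    (h : G.Edge q p) :
    q ∈ G.forwardSet (SCG.adjustmentSet Gs γmax x γ t) (x, t - (γ : ℤ)) (y, t) ∨
      q ∈ SCG.adjustmentSet Gs γmax x γ t ∨ q = (x, t - (γ : ℤ)) := by
  by_cases hqA : q ∈ SCG.adjustmentSet Gs γmax x γ t
  · exact .inr (.inl hqA)
  by_cases hqi : q = (x, t - (γ : ℤ))
  · exact .inr (.inr hqi)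
  refine .inl ⟨?_, hqA, hqi, .head ⟨h, hqi, hp.2.2.1⟩ hp.2.2.2⟩
  by_contra hlt
  have h₁ := G.lag_le _ _ h
  have h₂ : t - γ ≤ p.2 := hp.1
  exact hqA (mem_adjustmentSet_of_lt (not_le.1 hlt) (by omega))

/-- The variables of `forwardSet` are not ancestors of the adjustment set. -/
theorem forwardSet_not_reflTransGen_adjustmentSet (hG : G.IsCandidate Gs) {p q : V × ℤ}
    (hp : p ∈ G.forwardSet (SCG.adjustmentSet Gs γmax x γ t) (x, t - (γ : ℤ)) (y, t))
    (hq : q ∈ SCG.adjustmentSet Gs γmax x γ t) : ¬ Relation.ReflTransGen G.Edge p q := by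
  intro h
  have h₁ := snd_le_of_reflTransGen h
  have h₂ : t - γ ≤ p.2 := hp.1
  rcases snd_lt_or_notMem_desc hq with h₃ | ⟨h₃, h₄⟩
  · omega
  · refine hp.2.1 (mem_adjustmentSet_of_notMem_desc (by omega) fun h₅ => h₄ ?_)
    exact Relation.ReflTransGen.trans h₅ (hG.isAnc h)

/-- The variables of `forwardSet` are not ancestors of the treatment. -/
theorem forwardSet_not_reflTransGen_treatment (hG : G.IsCandidate Gs) (hxy : x ≠ y)
    (hyp : ¬ SCG.IsAnc Gs x y ∨
      (SCG.IsAnc Gs x y ∧ ¬ SCG.CycleCondition Gs x y γ ∧ ¬ SCG.BackdoorCondition Gs x y γ))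
    {p : V × ℤ}
    (hp : p ∈ G.forwardSet (SCG.adjustmentSet Gs γmax x γ t) (x, t - (γ : ℤ)) (y, t)) :
    ¬ Relation.ReflTransGen G.Edge p (x, t - (γ : ℤ)) := by
  intro hpi
  obtain ⟨h₁, hpA, hpne, hpj⟩ := hp
  have hpt : p.2 = t - γ := le_antisymm (snd_le_of_reflTransGen hpi) h₁
  have hpx : p.1 ≠ x := fun h => hpne (Prod.ext h hpt)
  have hdesc : SCG.IsAnc Gs x p.1 := by
    by_contra h; exact hpA (mem_adjustmentSet_of_notMem_desc hpt h)
  have hanc : SCG.IsAnc Gs p.1 x := hG.isAnc hpi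
  have hpy : SCG.IsAnc Gs p.1 y := hG.isAnc (reflTransGen_of_avoiding hpj)
  rcases hyp with hyp | ⟨hxya, hc, hb⟩
  · exact hyp (hdesc.trans hpy)
  by_cases hγ : γ = 0
  · subst hγ
    obtain ⟨π, hπ, hπb, hd, hlen⟩ := SCG.exists_backdoorPath hxy hdesc hanc
      (isAnc_removeVertex_of_avoiding hG hpj h₁ (by simp))
    -- With γ = 0, clauses (a) and (b) cover every length at least 2.
    refine hb ⟨π, hπ, hπb,
      fun z hz => hd z (List.mem_of_mem_tail (List.mem_of_mem_dropLast hz)), ?_⟩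
    omega
  · obtain ⟨hpy', rfl, hloop⟩ := SCG.eq_of_mem_strongComponent hxy hγ hxya hc hb hpx hdesc hanc
    obtain ⟨w, s⟩ := p
    simp only at hpy' hpt
    subst hpy' hpt
    rcases Relation.ReflTransGen.cases_head hpj with h | ⟨c, hpc, hcj⟩
    · simp at h
    have hcj' := reflTransGen_of_avoiding hcj
    have hwc : Gs.Adj w c.1 := hG.adj hpc.1
    -- The successor `c` of Y_{t-1} is again in the strong component {X, Y}, and Y has no self-loop.
    -- As the path avoids X_{t-1}, `c` must be X_t.
    have hcx : c.1 = x := by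
      by_contra hne
      have hcw : SCG.IsAnc Gs c.1 w := hG.isAnc hcj'
      have h := SCG.eq_of_mem_strongComponent hxy hγ hxya hc hb hne (hdesc.tail hwc)
        (hcw.trans hanc)
      rw [h.1] at hwc
      exact hloop hwc
    have h₃ := G.time_le _ _ hpc.1
    have h₄ := snd_le_of_reflTransGen hcj'
    have h₅ : c.2 ≠ t - (1 : ℕ) := fun h => hpc.2.2 (Prod.ext hcx h)
    have hct : c = (x, t) := Prod.ext hcx (by simp only at *; omega)
    rw [hct] at hcj'
    -- Shifting the path from Y_{t-1} to X_{t-1} makes Y_t an ancestor of X_t, against the path from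
    -- X_t to Y_t.
    have h₆ := reflTransGen_shift 1 hpi
    simp only [Nat.cast_one, sub_add_cancel] at h₆
    exact hxy (congrArg Prod.fst (eq_of_reflTransGen_of_reflTransGen hcj' h₆))

end FTCG

/-! ### Independence and adjustment for a functional outcome. -/

namespace ProbabilityTheory

/-- The joint law is a threefold product, which can be rebracketed. -/
theorem IndepFun.prodMk_right_of_prodMk_left {Ω α β δ : Type*} [MeasurableSpace Ω]
    [MeasurableSpace α] [MeasurableSpace β] [MeasurableSpace δ] {μ : Measure Ω}
    [IsProbabilityMeasure μ] {f : Ω → α} {g : Ω → β} {h : Ω → δ} (hf : Measurable f)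
    (hg : Measurable g) (hh : Measurable h) (hfg : IndepFun f g μ)
    (hfgh : IndepFun (fun ω => (f ω, g ω)) h μ) : IndepFun f (fun ω => (g ω, h ω)) μ := by
  have := Measure.isProbabilityMeasure_map (μ := μ) hf.aemeasurable
  have := Measure.isProbabilityMeasure_map (μ := μ) hg.aemeasurable
  have := Measure.isProbabilityMeasure_map (μ := μ) hh.aemeasurable
  have hgh : IndepFun g h μ := hfgh.comp (φ := Prod.snd) (ψ := id) measurable_snd measurable_id
  rw [indepFun_iff_map_prod_eq_prod_map_map (by fun_prop) (by fun_prop)] at hfg hfgh hgh ⊢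
  rw [hgh]
  have e : (fun ω => (f ω, g ω, h ω)) = MeasurableEquiv.prodAssoc ∘ fun ω => ((f ω, g ω), h ω) :=
    rfl
  rw [e, ← Measure.map_map (by fun_prop) (by fun_prop), hfgh, hfg, Measure.prodAssoc_prod]

theorem iIndepFun.indepFun_of_disjoint {Ω ι : Type*} {β : ι → Type*} [MeasurableSpace Ω]
    [∀ k, MeasurableSpace (β k)] {μ : Measure Ω} {f : ∀ k, Ω → β k} (hf : iIndepFun f μ)
    (hm : ∀ k, Measurable (f k)) {S T : Set ι} (hST : Disjoint S T) :
    IndepFun (fun ω (k : S) => f k ω) (fun ω (k : T) => f k ω) μ := by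
  have h := indep_iSup_of_disjoint (fun k => (hm k).comap_le) hf hST
  rw [iSup_subtype', iSup_subtype'] at h
  rw [IndepFun_iff_Indep, MeasurableSpace.comap_process_pi (fun (k : S) ω => f k ω),
    MeasurableSpace.comap_process_pi (fun (k : T) ω => f k ω)]
  exact h

/-- If the outcome is `H (treatment, covariates) U` with `U` independent of the treatment and the
covariates, adjusting for the covariates gives the law of `H (a, covariates) U`. -/
theorem ae_map_eq_lintegral_condDistrib {Ω α β υ ψ : Type*} [MeasurableSpace Ω]
    [MeasurableSpace α] [MeasurableSpace β] [MeasurableSpace υ] [MeasurableSpace ψ]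
    [StandardBorelSpace ψ] [Nonempty ψ] {μ : Measure Ω} [IsProbabilityMeasure μ]
    {A : Ω → α} {Z : Ω → β} {U : Ω → υ} {Y : Ω → ψ} {H : (α × β) × υ → ψ}
    (hA : Measurable A) (hZ : Measurable Z) (hU : Measurable U) (hY : Measurable Y)
    (hH : Measurable H) (hYH : ∀ᵐ ω ∂μ, Y ω = H ((A ω, Z ω), U ω))
    (hind : IndepFun U (fun ω => (A ω, Z ω)) μ)
    (hac : (μ.map A).prod (μ.map Z) ≪ μ.map (fun ω => (A ω, Z ω))) :
    ∀ᵐ a ∂μ.map A, ∀ B : Set ψ, MeasurableSet B →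
      μ.map (fun ω => H ((a, Z ω), U ω)) B =
        ∫⁻ z, condDistrib Y (fun ω => (A ω, Z ω)) μ (a, z) B ∂μ.map Z := by
  have hW : Measurable fun ω => (A ω, Z ω) := hA.prodMk hZ
  have := Measure.isProbabilityMeasure_map (μ := μ) hA.aemeasurable
  have := Measure.isProbabilityMeasure_map (μ := μ) hZ.aemeasurable
  have := Measure.isProbabilityMeasure_map (μ := μ) hU.aemeasurable
  have := Measure.isProbabilityMeasure_map (μ := μ) hW.aemeasurable
  -- `κ w` is the law of `H (w, U)` with `w` frozen; independence and uniqueness of disintegration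
  -- identify it with the conditional law.
  let κ : Kernel (α × β) ψ := (Kernel.id ×ₖ Kernel.const (α × β) (μ.map U)).map H
  have hκ : ∀ w, κ w = (μ.map U).map fun u => H (w, u) := by
    intro w
    simp only [κ]
    rw [Kernel.map_apply _ hH, Kernel.prod_apply, Kernel.id_apply, Kernel.const_apply,
      Measure.dirac_prod, Measure.map_map hH (by fun_prop)]
    rfl
  have : IsMarkovKernel κ := Kernel.IsMarkovKernel.map _ hH
  have hindW := hind.symm
  rw [indepFun_iff_map_prod_eq_prod_map_map (by fun_prop) (by fun_prop)] at hindW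
  have hcond : condDistrib Y (fun ω => (A ω, Z ω)) μ =ᵐ[μ.map fun ω => (A ω, Z ω)] κ := by
    refine condDistrib_ae_eq_of_measure_eq_compProd _ hY.aemeasurable ?_
    have e : (fun ω => ((A ω, Z ω), Y ω)) =ᵐ[μ]
        (fun p : (α × β) × υ => (p.1, H p)) ∘ fun ω => ((A ω, Z ω), U ω) := by
      filter_upwards [hYH] with ω h
      simp [h]
    rw [Measure.map_congr e, ← Measure.map_map (by fun_prop) (by fun_prop), hindW]
    ext s hs
    have hm : Measurable fun p : (α × β) × υ => (p.1, H p) := by fun_prop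
    rw [Measure.map_apply hm hs, Measure.prod_apply (hm hs), Measure.compProd_apply hs]
    refine lintegral_congr fun w => ?_
    rw [hκ, Measure.map_apply (by fun_prop) (measurable_prodMk_left hs)]
    rfl
  -- The identity holds almost everywhere for the joint law; `hac` carries it to the product law,
  -- where Fubini fixes `a`.
  have h2 := Measure.ae_ae_of_ae_prod (hac.ae_le hcond)
  filter_upwards [h2] with a ha B hB
  have hind' : IndepFun Z U μ :=
    hind.symm.comp (φ := Prod.snd) (ψ := id) measurable_snd measurable_id
  rw [indepFun_iff_map_prod_eq_prod_map_map (by fun_prop) (by fun_prop)] at hind'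
  have e : (fun ω => H ((a, Z ω), U ω)) =
      (fun p : β × υ => H ((a, p.1), p.2)) ∘ fun ω => (Z ω, U ω) := rfl
  have hm : Measurable fun p : β × υ => H ((a, p.1), p.2) := by fun_prop
  rw [e, ← Measure.map_map hm (by fun_prop), hind', Measure.map_apply hm hB,
    Measure.prod_apply (hm hB)]
  refine lintegral_congr_ae ?_
  filter_upwards [ha] with z hz
  rw [hz, hκ, Measure.map_apply (by fun_prop) hB]
  rfl

end ProbabilityTheory

/-! ### Solving the structural equations and the adjustment formula. -/

namespace DSCM

section InsertValue

variable {V : Type u} {E : V → Type v}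

open Classical in
/-- The values on `insert i A` given by a value at `i` and values on `A`. -/
noncomputable def insertValue {i : V × ℤ} {A : Set (V × ℤ)} (c : E i.1 × ∀ p : A, E p.1.1)
    (p : (insert i A : Set (V × ℤ))) : E p.1.1 :=
  if h : p.1 = i then cast (by rw [h]) c.1 else c.2 ⟨p.1, p.2.resolve_left h⟩

theorem measurable_insertValue [∀ b, MeasurableSpace (E b)] {i : V × ℤ} {A : Set (V × ℤ)} :
    Measurable (insertValue (E := E) (i := i) (A := A)) := by
  refine measurable_pi_lambda _ fun p => ?_
  obtain ⟨p, hp⟩ := p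
  by_cases h : p = i
  · subst h
    simpa [insertValue] using measurable_fst (α := E p.1)
  · simp only [insertValue, h, dif_neg, not_false_eq_true]
    fun_prop

theorem insertValue_restrict {i : V × ℤ} {A : Set (V × ℤ)} (x : ∀ p : V × ℤ, E p.1) :
    insertValue (i := i) (A := A) (x i, fun p : A => x p.1) =
      fun p : (insert i A : Set (V × ℤ)) => x p.1 := by
  funext ⟨p, hp⟩
  by_cases h : p = i
  · subst h; simp [insertValue]
  · simp [insertValue, h]

end InsertValue

variable {V : Type u} {γmax : ℕ} {G : FTCG V γmax} {E : V → Type v} [∀ b, MeasurableSpace (E b)]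

/-- Under positivity, the product of the laws of `i` and of a finite set `A` not containing `i` is
absolutely continuous with respect to their joint law. -/
theorem IsPositive.prod_absolutelyContinuous {M : DSCM.{u, v, w, w'} G E}
    {lam : ∀ b, Measure (E b)} [∀ b, SigmaFinite (lam b)] (hM : M.IsPositive lam) {i : V × ℤ}
    {A : Set (V × ℤ)} (hA : A.Finite) (hi : i ∉ A) :
    (M.P.map (M.X i)).prod (M.P.map fun ω (p : A) => M.X p.1 ω) ≪
      M.P.map fun ω => (M.X i ω, fun p : A => M.X p.1 ω) := by
  classical
  have := M.measurable_X
  obtain ⟨F, rfl⟩ : ∃ F : Finset (V × ℤ), (F : Set (V × ℤ)) = A := hA.exists_finset_coe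
  have hd : Disjoint ({i} : Finset (V × ℤ)) F := by simpa using hi
  have hpres := measurePreserving_piFinsetUnion hd (fun p : V × ℤ => lam p.1)
  let e := MeasurableEquiv.piFinsetUnion (fun p : V × ℤ => E p.1) hd
  have hmeas : ∀ S : Finset (V × ℤ), Measurable fun ω (p : S) => M.X p.1 ω := fun S =>
    measurable_pi_lambda _ fun p => M.measurable_X _
  have hfin : ∀ S : Finset (V × ℤ), IsProbabilityMeasure (M.P.map fun ω (p : S) => M.X p.1 ω) :=
    fun S => Measure.isProbabilityMeasure_map (hmeas S).aemeasurable
  -- The reference product is the intermediary: it dominates the product of the marginals and is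
  -- dominated by the joint law.
  have h₁ := (hM {i}).1.prod (hM F).1
  have h₂ : (Measure.pi fun p : ({i} : Finset (V × ℤ)) => lam p.1.1).prod
      (Measure.pi fun p : F => lam p.1.1) ≪
      M.P.map fun ω => ((fun p : ({i} : Finset (V × ℤ)) => M.X p.1 ω), fun p : F => M.X p.1 ω) := by
    have h₃ := (hM ({i} ∪ F)).2.map e.symm.measurable
    rw [← hpres.map_eq, Measure.map_map e.symm.measurable e.measurable, e.symm_comp_self,
      Measure.map_id, Measure.map_map e.symm.measurable (hmeas _)] at h₃
    convert h₃ using 2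
    funext ω
    simp only [Function.comp]
    rw [MeasurableEquiv.eq_symm_apply]
    funext p
    rcases Finset.mem_union.1 p.2 with h | h
    · exact (Equiv.piFinsetUnion_left (fun p : V × ℤ => E p.1) hd h p.2)
    · exact (Equiv.piFinsetUnion_right (fun p : V × ℤ => E p.1) hd h p.2)
  have hev : Measurable fun g : (∀ p : ({i} : Finset (V × ℤ)), E p.1.1) =>
      g ⟨i, Finset.mem_singleton_self i⟩ := measurable_pi_apply _
  have h₄ := (h₁.trans h₂).map (hev.prodMap (measurable_id (α := ∀ p : F, E p.1.1)))
  rw [← Measure.map_prod_map _ _ hev measurable_id, Measure.map_id,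
    Measure.map_map hev (hmeas _), Measure.map_map (hev.prodMap measurable_id)
      ((hmeas _).prodMk (hmeas _))] at h₄
  exact h₄

section Solve

variable [Finite V] [∀ b, Nonempty (E b)] (M : DSCM.{u, v, w, w'} G E)

open Classical in
/-- The values computed by the mechanisms on `S`, from given values on `K` and noises on `S`. -/
noncomputable def solve {t₀ : ℤ} {S : Set (V × ℤ)} (hS : ∀ p ∈ S, t₀ ≤ p.2) (K : Set (V × ℤ))
    (z : ∀ p : K, E p.1.1) (u : ∀ p : S, M.Noise p.1.1) : ∀ p : V × ℤ, E p.1 :=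
  (G.wellFounded_from t₀).fix (C := fun p => E p.1) fun p rec =>
    if hp : p ∈ S then
      M.f p.1 (fun q => rec (q.1.1, q.1.2 + p.2) ⟨q.edge p.2, hS p hp⟩) (u ⟨p, hp⟩)
    -- The default is irrelevant on `S ∪ K` when all parents of `S` lie in `S ∪ K`.
    else if hp : p ∈ K then z ⟨p, hp⟩ else Classical.arbitrary _

variable {t₀ : ℤ} {S : Set (V × ℤ)} (hS : ∀ p ∈ S, t₀ ≤ p.2) (K : Set (V × ℤ))

open Classical in
theorem solve_apply (z : ∀ p : K, E p.1.1) (u : ∀ p : S, M.Noise p.1.1) (p : V × ℤ) :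
    M.solve hS K z u p = if hp : p ∈ S then
      M.f p.1 (fun q => M.solve hS K z u (q.1.1, q.1.2 + p.2)) (u ⟨p, hp⟩)
    else if hp : p ∈ K then z ⟨p, hp⟩ else Classical.arbitrary _ := by
  rw [solve, WellFounded.fix_eq]

theorem measurable_solve (p : V × ℤ) :
    Measurable fun c : (∀ p : K, E p.1.1) × (∀ p : S, M.Noise p.1.1) =>
      M.solve hS K c.1 c.2 p := by
  induction p using (G.wellFounded_from t₀).induction with
  | _ p ih =>
    rw [funext fun c : (∀ p : K, E p.1.1) × (∀ p : S, M.Noise p.1.1) =>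
      M.solve_apply hS K c.1 c.2 p]
    split_ifs with h h'
    · refine (M.measurable_f p.1).comp (Measurable.prodMk (measurable_pi_lambda _ fun q => ?_) ?_)
      · exact ih _ ⟨q.edge p.2, hS p h⟩
      · fun_prop
    · fun_prop
    · exact measurable_const

/-- The structural equations on `S` determine the values there. -/
theorem solve_eq (hpar : ∀ p ∈ S, ∀ q, G.Edge q p → q ∈ S ∨ q ∈ K)
    {x : ∀ p : V × ℤ, E p.1} {u : ∀ p : V × ℤ, M.Noise p.1}
    (hx : ∀ p ∈ S, x p = M.f p.1 (fun q => x (q.1.1, q.1.2 + p.2)) (u p)) (p : V × ℤ)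
    (hp : p ∈ S ∨ p ∈ K) : M.solve hS K (fun p => x p.1) (fun p => u p.1) p = x p := by
  induction p using (G.wellFounded_from t₀).induction with
  | _ p ih =>
    rw [solve_apply]
    split_ifs with h h'
    · rw [hx p h]
      congr 1
      funext q
      exact ih _ ⟨q.edge p.2, hS p h⟩ (hpar p h _ (q.edge p.2))
    · rfl
    · exact absurd hp (by tauto)

end Solve

variable [Finite V] (M : DSCM.{u, v, w, w'} G E)

theorem ae_structural : ∀ᵐ ω ∂M.P, ∀ p : V × ℤ,
    M.X p ω = M.f p.1 (fun q => M.X (q.1.1, q.1.2 + p.2) ω) (M.U p ω) := by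
  have : Countable V := Finite.to_countable
  exact ae_all_iff.2 fun p => M.structural p.1 p.2

/-- An intervention does not change the variables that do not descend from the treatment. -/
theorem doX_eq_of_not_reflTransGen {i : V × ℤ} (a : E i.1) {ω : M.Ω}
    (hω : ∀ p : V × ℤ, M.X p ω = M.f p.1 (fun q => M.X (q.1.1, q.1.2 + p.2) ω) (M.U p ω))
    (p : V × ℤ) (hp : ¬ Relation.ReflTransGen G.Edge i p) : M.doX i a ω p = M.X p ω := by
  induction p using (G.wellFounded_from i.2).induction with
  | _ p ih =>
    by_cases h : p.2 < i.2
    · exact M.doX_of_lt i a ω p h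
    · rw [M.doX_of_ne i a ω p (not_lt.1 h) (fun h => hp (h ▸ .refl)), hω p]
      congr 1
      funext q
      exact ih _ ⟨q.edge p.2, not_lt.1 h⟩ fun h' => hp (h'.tail (q.edge p.2))

/-- The noises on `S` are independent of the variables that descend from none of them. -/
theorem indepFun_noise [∀ b, Nonempty (E b)] {t₀ : ℤ} {S B : Set (V × ℤ)}
    (hS : ∀ p ∈ S, t₀ ≤ p.2) (hSB : ∀ p ∈ S, ∀ q ∈ B, ¬ Relation.ReflTransGen G.Edge p q) :
    IndepFun (fun ω (p : S) => M.U p.1 ω) (fun ω (p : B) => M.X p.1 ω) M.P := by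
  -- The variables on `B` are a function of the noises on `T`, which is disjoint from `S`, and of
  -- the past before `t₀`; the noises on `S` are independent of both jointly.
  let T : Set (V × ℤ) := {p | t₀ ≤ p.2 ∧ ∃ q ∈ B, Relation.ReflTransGen G.Edge p q}
  let K : Set (V × ℤ) := {p | p.2 < t₀}
  have hT : ∀ p ∈ T, t₀ ≤ p.2 := fun p hp => hp.1
  have hST : Disjoint S T :=
    Set.disjoint_left.2 fun p hp ⟨_, q, hq, h⟩ => hSB p hp q hq h
  have hX := M.measurable_X
  have hU := M.measurable_U
  have h₁ := M.noise_indep.indepFun_of_disjoint M.measurable_U hST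
  have h₂ : IndepFun (fun ω => ((fun p : S => M.U p.1 ω), fun p : T => M.U p.1 ω))
      (fun ω (p : K) => M.X p.1 ω) M.P :=
    (M.noise_indep_past t₀).comp (ψ := id)
      (φ := fun c => ((fun p : S => c ⟨p.1, hS _ p.2⟩), fun p : T => c ⟨p.1, hT _ p.2⟩))
      (by fun_prop) measurable_id
  have h₃ := h₁.prodMk_right_of_prodMk_left (by fun_prop) (by fun_prop) (by fun_prop) h₂
  have h₄ := h₃.comp (φ := id)
    (ψ := fun (c : (∀ p : T, M.Noise p.1.1) × (∀ p : K, E p.1.1)) (p : B) =>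
      M.solve hT K c.2 c.1 p.1) measurable_id
    (measurable_pi_lambda _ fun p => (M.measurable_solve hT K p.1).comp measurable_swap)
  refine h₄.congr (.refl _ _) ?_
  filter_upwards [M.ae_structural] with ω hω
  funext p
  refine M.solve_eq hT K (x := fun p => M.X p ω) (u := fun p => M.U p ω) ?_ (fun p _ => hω p) p ?_
  · rintro p ⟨-, r, hr, hpr⟩ q hq
    by_cases h : t₀ ≤ q.2
    · exact .inl ⟨h, r, hr, .head hq hpr⟩
    · exact .inr (not_le.1 h)
  · by_cases h : t₀ ≤ p.1.2
    · exact .inl ⟨h, p, p.2, .refl⟩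
    · exact .inr (not_le.1 h)

/-- The backdoor adjustment: `A` contains no descendant of `i`, the set `S` with its noises and the
variables of `A ∪ {i}` generates `j`, and `S` contains no ancestor of `A ∪ {i}`. -/
theorem adjustmentFormula_of_separated [∀ b, StandardBorelSpace (E b)] [∀ b, Nonempty (E b)]
    {lam : ∀ b, Measure (E b)} [∀ b, SigmaFinite (lam b)] (hM : M.IsPositive lam) {i j : V × ℤ}
    {A S : Set (V × ℤ)} (hA : A.Finite) (hiA : ∀ q ∈ A, ¬ Relation.ReflTransGen G.Edge i q)
    (hS : ∀ p ∈ S, i.2 ≤ p.2) (hiS : i ∉ S) (hj : j ∈ S ∨ j ∈ A)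
    (hpar : ∀ p ∈ S, ∀ q, G.Edge q p → q ∈ S ∨ q ∈ insert i A)
    (hsep : ∀ p ∈ S, ∀ q ∈ insert i A, ¬ Relation.ReflTransGen G.Edge p q) :
    M.AdjustmentFormula i j A := by
  have hX := M.measurable_X
  have hU := M.measurable_U
  let H : (E i.1 × ∀ p : A, E p.1.1) × (∀ p : S, M.Noise p.1.1) → E j.1 := fun c =>
    M.solve hS (insert i A) (insertValue c.1) c.2 j
  have hH : Measurable H := (M.measurable_solve hS (insert i A) j).comp
    ((measurable_insertValue.comp measurable_fst).prodMk measurable_snd)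
  have hj' : j ∈ S ∨ j ∈ insert i A := hj.imp_right (Set.mem_insert_of_mem _)
  -- Stated for any solution of the equations on `S`, so that it serves both the observed and the
  -- intervened process; the latter keeps these equations because `i ∉ S`.
  have hHx : ∀ (x : ∀ p : V × ℤ, E p.1) (u : ∀ p : V × ℤ, M.Noise p.1),
      (∀ p ∈ S, x p = M.f p.1 (fun q => x (q.1.1, q.1.2 + p.2)) (u p)) →
      H ((x i, fun p => x p.1), fun p => u p.1) = x j := by
    intro x u hx
    simp only [H]
    rw [insertValue_restrict]
    exact M.solve_eq hS _ hpar hx j hj'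
  have hind := (M.indepFun_noise hS hsep).comp (φ := id)
    (ψ := fun c => (c ⟨i, Set.mem_insert i A⟩, fun p : A => c ⟨p.1, Set.mem_insert_of_mem _ p.2⟩))
    measurable_id (by fun_prop)
  have key := ae_map_eq_lintegral_condDistrib (μ := M.P) (A := M.X i)
    (Z := fun ω (p : A) => M.X p.1 ω) (U := fun ω (p : S) => M.U p.1 ω) (Y := M.X j) (H := H)
    (by fun_prop) (by fun_prop) (by fun_prop) (by fun_prop) hH
    (by
      filter_upwards [M.ae_structural] with ω hω
      exact (hHx (fun p => M.X p ω) (fun p => M.U p ω) fun p _ => hω p).symm)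
    hind (hM.prod_absolutelyContinuous hA fun h => hiA i h .refl)
  filter_upwards [key] with a ha B hB
  rw [← ha B hB, effect]
  congr 1
  refine Measure.map_congr ?_
  filter_upwards [M.ae_structural] with ω hω
  rw [← hHx (M.doX i a ω) (fun p => M.U p ω)
    fun p hp => M.doX_of_ne i a ω p (hS p hp) fun h => hiS (h ▸ hp), M.doX_self]
  congr 2
  refine Prod.ext rfl ?_
  funext p
  exact M.doX_eq_of_not_reflTransGen a hω p (hiA p p.2)

end DSCM

/-! ### From adjustment to identifiability. -/

namespace SCG

variable {V : Type u} [Finite V] {E : V → Type v} [∀ b, MeasurableSpace (E b)]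

open Classical in
/-- The right-hand side of the adjustment formula, as a functional of the observational law. -/
noncomputable def adjustmentFunctional [∀ b, StandardBorelSpace (E b)] [∀ b, Nonempty (E b)]
    (i j : V × ℤ) (Z : Set (V × ℤ)) (μ : Measure (∀ p : V × ℤ, E p.1)) (a : E i.1) :
    Measure (E j.1) :=
  -- `condDistrib` requires a finite measure; observational laws always fall in this branch.
  if _h : IsFiniteMeasure μ then
    (μ.map fun x (p : Z) => x p.1).bind fun z =>
      condDistrib (fun x => x j) (fun x => (x i, fun p : Z => x p.1)) μ (a, z)
  else 0

/-- A valid adjustment set identifies the effect. -/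
theorem IsValidAdjustmentSet.isIdentifiable [∀ b, StandardBorelSpace (E b)] [∀ b, Nonempty (E b)]
    {lam : ∀ b, Measure (E b)} {Gs : Digraph V} {γmax : ℕ} {i j : V × ℤ} {Z : Set (V × ℤ)}
    (h : IsValidAdjustmentSet.{u, v, w, w'} E lam Gs γmax i j Z) :
    IsIdentifiable.{u, v, w, w'} E lam Gs γmax i j := by
  refine ⟨adjustmentFunctional i j Z, fun G hG M hM => ?_⟩
  have hX := M.measurable_X
  have hm : Measurable fun ω p => M.X p ω := measurable_pi_lambda _ M.measurable_X
  have hfin : IsProbabilityMeasure M.obsLaw := Measure.isProbabilityMeasure_map hm.aemeasurable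
  filter_upwards [h G hG M hM] with a ha
  ext B hB
  have hcond : condDistrib (fun x => x j) (fun x => (x i, fun p : Z => x p.1)) M.obsLaw =
      condDistrib (M.X j) (fun ω => (M.X i ω, fun p : Z => M.X p.1 ω)) M.P := by
    rw [condDistrib, condDistrib]
    congr 1
    rw [DSCM.obsLaw, Measure.map_map (by fun_prop) hm]
    rfl
  have hmap : M.obsLaw.map (fun x (p : Z) => x p.1) = M.P.map fun ω (p : Z) => M.X p.1 ω := by
    rw [DSCM.obsLaw, Measure.map_map (by fun_prop) hm]
    rfl
  rw [ha B hB, adjustmentFunctional,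
    dif_pos (show IsFiniteMeasure M.obsLaw from inferInstance), hmap, hcond, Measure.bind_apply hB]
  exact ((Kernel.measurable _).comp measurable_prodMk_left).aemeasurable

end SCG

theorem mainTheorem2 {V : Type u} [Finite V] (E : V → Type v) [∀ b, MeasurableSpace (E b)]
    [∀ b, StandardBorelSpace (E b)] [∀ b, Nonempty (E b)]
    (lam : ∀ b, Measure (E b)) [∀ b, SigmaFinite (lam b)]
    (Gs : Digraph V) (γmax γ : ℕ) (t : ℤ) (x y : V) (hxy : x ≠ y)
    (h : ¬ SCG.IsAnc Gs x y ∨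
      (SCG.IsAnc Gs x y ∧ ¬ SCG.CycleCondition Gs x y γ ∧ ¬ SCG.BackdoorCondition Gs x y γ)) :
    SCG.IsIdentifiable.{u, v, w, w'} E lam Gs γmax (x, t - γ) (y, t) ∧
      SCG.IsValidAdjustmentSet.{u, v, w, w'} E lam Gs γmax (x, t - γ) (y, t)
        (SCG.adjustmentSet Gs γmax x γ t) := by
  suffices hv : SCG.IsValidAdjustmentSet.{u, v, w, w'} E lam Gs γmax (x, t - γ) (y, t)
      (SCG.adjustmentSet Gs γmax x γ t) from ⟨hv.isIdentifiable, hv⟩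
  intro G hG M hM
  refine M.adjustmentFormula_of_separated hM
    (S := G.forwardSet (SCG.adjustmentSet Gs γmax x γ t) (x, t - γ) (y, t))
    FTCG.finite_adjustmentSet (fun q hq => FTCG.not_reflTransGen_adjustmentSet hG hq)
    (fun p hp => hp.1) (fun hp => hp.2.2.1 rfl) ?_ ?_ ?_
  -- Y_t itself is adjusted for when γ = 0 and Y is not a descendant of X.
  · by_cases hj : (y, t) ∈ SCG.adjustmentSet Gs γmax x γ t
    · exact .inr hj
    · exact .inl ⟨by simp, hj, fun h => hxy (congrArg Prod.fst h).symm, .refl⟩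
  · exact fun p hp q hq => (FTCG.forwardSet_parent hp hq).imp_right Or.symm
  · rintro p hp q (rfl | hq)
    · exact FTCG.forwardSet_not_reflTransGen_treatment hG hxy h hp
    · exact FTCG.forwardSet_not_reflTransGen_adjustmentSet hG hp hq
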